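/- Consider the linear model $y = X\beta + \varepsilon$ with a fixed design $X \in \mathbb{R}^{n\times p}$, $\beta\in\mathbb{R}^p$ and $\varepsilon \sim N(0,\sigma^2 I_n)$. Split the rows into two parts, $y = \binom{y^{(1)}}{y^{(2)}}$, $X = \binom{X^{(1)}}{X^{(2)}}$ with $n = n_1+n_2$, where the split does not depend on $y$. The knockoff procedure for protolasso is as follows. 1. Let $\{C_1,\dots,C_K\}$ be a fixed partition of the column indices $\{1,\dots,p\}$ into nonempty clusters (it may depend on $X$, but not on $y$). 2. Prototypes $\hat P = \{\hat P_1,\dots,\hat P_K\}$ are chosen from the first part of the data only: $\hat P_k \in \operatorname{argmax}_{j\in C_k} |x_j^{(1)\top} y^{(1)}|$, where $x^{(1)}_j$ is the $j$-th column of $X^{(1)}$; ties are broken by a fixed measurable rule depending on $y^{(1)}$ only. 3. Let $\tilde X^{(2)}\in\mathbb{R}^{n_2\times p}$ be a fixed knockoff matrix of the whole matrix $X^{(2)}$: $\tilde X^{(2)\top}\tilde X^{(2)} = X^{(2)\top}X^{(2)}$ and $X^{(2)\top}\tilde X^{(2)} = X^{(2)\top}X^{(2)} - \operatorname{diag}(s)$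 for some $s\in\mathbb{R}^p$ with nonnegative entries. Let $X^{(2)}_{\hat P}$ and $\tilde X^{(2)}_{\hat P}$ be the $n_2\times K$ matrices whose $k$-th columns are the $\hat P_k$-th columns of $X^{(2)}$ and $\tilde X^{(2)}$. 4. Let $W^{(2)} = (W^{(2)}_1,\dots,W^{(2)}_K) = W\big(X^{(2)}_{\hat P}, \tilde X^{(2)}_{\hat P}, y^{(2)}\big)$, where $W$ is a rule assigning to $A,B\in\mathbb{R}^{n_2\times K}$ and $z\in\mathbb{R}^{n_2}$ a vector $W(A,B,z)\in\mathbb{R}^K$, measurable in $z$, such that (sufficiency) $W(A,B,z)$ is a function of $[A\ B]^\top[A\ B]$ and $[A\ B]^\top z$ only, and (antisymmetry) for every $S\subseteq\{1,\dots,K\}$, swapping the $k$-th columns of $A$ and $B$ for all $k\in S$ changes the sign of $W_k(A,B,z)$ for $k\in S$ and leaves $W_k(A,B,z)$ unchanged for $k\notin S$. For $q\in[0,1]$ let $$T = \min\left\{t\in\mathcal{W} : \frac{1+\#\{k : W^{(2)}_k\le -t\}}{\#\{k : W^{(2)}_k\ge t\}\vee 1}\le q\right\},\qquad \mathcal{W}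 = \{|W^{(2)}_k| : 1\le k\le K\}\setminus\{0\},$$ with $T=+\infty$ if the set is empty, and let $\hat S = \{k : W^{(2)}_k\ge T\}$. Then $$E\left[\frac{\#\{k\in\hat S : \beta_{\hat P_k}=0\}}{\#\hat S\vee 1}\right]\le q,$$ where the expectation is taken over the joint distribution of $y^{(1)}$ and $y^{(2)}$. -/

import Mathlib

open MeasureTheory ProbabilityTheory

noncomputable section

namespace Protolasso

/-- `C 0, …, C (K-1)` is a clustering of the `p` columns: nonempty, pairwise disjoint sets
covering all column indices. -/
structure IsClustering {p K : ℕ} (C : Fin K → Finset (Fin p)) : Prop where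
  nonempty : ∀ k, (C k).Nonempty
  disjoint : ∀ k l, k ≠ l → Disjoint (C k) (C l)
  cover : ∀ j, ∃ k, j ∈ C k

/-- `proto` maps a response vector `y` to prototypes, one from each cluster, that maximise the
absolute marginal inner product `|x_jᵀ y|` over the cluster. Ties may be broken by any measurable
rule. -/
structure IsPrototypeRule {n p K : ℕ} (X : Matrix (Fin n) (Fin p) ℝ) (C : Fin K → Finset (Fin p))
    (proto : (Fin n → ℝ) → Fin K → Fin p) : Prop where
  mem : ∀ y k, proto y k ∈ C k
  argmax : ∀ y k, ∀ j ∈ C k, |X.col j ⬝ᵥ y| ≤ |X.col (proto y k) ⬝ᵥ y|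
  measurable : Measurable proto

/-- `Xk` is a (fixed-design) knockoff matrix of `X`: `Xkᵀ Xk = Xᵀ X` and
`Xᵀ Xk = Xᵀ X - diag s` for some nonnegative vector `s`. -/
def IsKnockoff {n p : ℕ} (X Xk : Matrix (Fin n) (Fin p) ℝ) : Prop :=
  ∃ s : Fin p → ℝ, (∀ j, 0 ≤ s j) ∧
    Xk.transpose * Xk = X.transpose * X ∧
    X.transpose * Xk = X.transpose * X - Matrix.diagonal s

/-- The matrix `X_P` whose `k`-th column is column `P k` of `X`. -/
def reduceCols {n p K : ℕ} (X : Matrix (Fin n) (Fin p) ℝ) (P : Fin K → Fin p) :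
    Matrix (Fin n) (Fin K) ℝ :=
  X.submatrix id P

/-- The matrix obtained from `A` on replacing its columns with index in `S` by those of `B`.
The pair `(exchange S A B, exchange S B A)` is the augmented matrix `[A B]` with the columns
`A_k` and `B_k` swapped for every `k ∈ S`. -/
def exchange {n K : ℕ} (S : Finset (Fin K)) (A B : Matrix (Fin n) (Fin K) ℝ) :
    Matrix (Fin n) (Fin K) ℝ :=
  Matrix.of fun i k => if k ∈ S then B i k else A i k

/-- A rule that assigns to the originals `A`, the knockoffs `B` and the response `y` one statistic
for each original-knockoff pair, with the sufficiency and the antisymmetry property. -/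
structure IsKnockoffStatistic {n K : ℕ}
    (W : Matrix (Fin n) (Fin K) ℝ → Matrix (Fin n) (Fin K) ℝ → (Fin n → ℝ) → Fin K → ℝ) :
    Prop where
  /-- `W` depends on the data only through the Gram matrix `[A B]ᵀ [A B]` and `[A B]ᵀ y`. -/
  sufficiency : ∃ f : Matrix (Fin K ⊕ Fin K) (Fin K ⊕ Fin K) ℝ → (Fin K ⊕ Fin K → ℝ) →
      Fin K → ℝ, ∀ A B y,
    W A B y = f ((Matrix.fromCols A B).transpose * Matrix.fromCols A B)
      ((Matrix.fromCols A B).transpose.mulVec y)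
  /-- Swapping `A_k` and `B_k` for all `k ∈ S` flips the sign of `W_k` exactly for `k ∈ S`. -/
  antisymmetry : ∀ (S : Finset (Fin K)) A B y k,
    W (exchange S A B) (exchange S B A) y k = if k ∈ S then - W A B y k else W A B y k
  measurable : ∀ A B, Measurable (W A B)

/-- The estimated false discovery proportion of knockoff+ at level `t`. -/
def fdpEstimate {K : ℕ} (w : Fin K → ℝ) (t : ℝ) : ℝ :=
  (1 + ((Finset.univ.filter fun k => w k ≤ -t).card : ℝ)) /
    max ((Finset.univ.filter fun k => t ≤ w k).card : ℝ) 1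

/-- The knockoff+ threshold: the least `t` among the nonzero `|w k|` whose estimated false
discovery proportion is at most `q`, and `⊤` (that is, `+∞`) if there is none. -/
def threshold {K : ℕ} (q : ℝ) (w : Fin K → ℝ) : WithTop ℝ :=
  (((Finset.univ.image fun k => |w k|).erase 0).filter fun t => fdpEstimate w t ≤ q).min

/-- The indices selected by knockoff+ at target level `q`. -/
def selected {K : ℕ} (q : ℝ) (w : Fin K → ℝ) : Finset (Fin K) :=
  Finset.univ.filter fun k => threshold q w ≤ (w k : WithTop ℝ)

/-- The statistics `W⁽²⁾` of the knockoff procedure for protolasso: the prototypes come from the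
first half `y₁` of the response, `X₂` and its knockoff `Xk₂` are reduced to the prototype columns,
and the statistic is evaluated with the second half `y₂`. -/
def procedureStat {n₁ n₂ p K : ℕ} (X₂ Xk₂ : Matrix (Fin n₂) (Fin p) ℝ)
    (proto : (Fin n₁ → ℝ) → Fin K → Fin p)
    (W : Matrix (Fin n₂) (Fin K) ℝ → Matrix (Fin n₂) (Fin K) ℝ → (Fin n₂ → ℝ) → Fin K → ℝ)
    (y : Fin n₁ ⊕ Fin n₂ → ℝ) : Fin K → ℝ :=
  W (reduceCols X₂ (proto (y ∘ Sum.inl))) (reduceCols Xk₂ (proto (y ∘ Sum.inl))) (y ∘ Sum.inr)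

/-- The false discovery proportion among the selected prototypes `P k`, `k ∈ S`; a discovery is
false if the coefficient of the prototype in the full linear model vanishes. -/
def fdp {p K : ℕ} (β : Fin p → ℝ) (P : Fin K → Fin p) (S : Finset (Fin K)) : ℝ :=
  ((S.filter fun k => β (P k) = 0).card : ℝ) / max (S.card : ℝ) 1

end Protolasso

end

namespace Protolasso

/-! Given the first half of the data the prototypes are fixed, so it suffices to control the FDR for
fixed distinct columns `P` and to integrate over the first half.

For a null `k`, reflect the response space in the hyperplane orthogonal to the difference of column
`P k` and its knockoff. This swaps the two columns, fixes the other reduced columns and, since the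
knockoff is built for the whole design and `β (P k) = 0`, also fixes the mean `X β`. The Gaussian
noise law is invariant, so sufficiency and antisymmetry make the law of `W` invariant under flipping
the sign of `W k` alone (`measurePreserving_flipAt_statistic`).

Invariance under single null flips already suffices, by a leave-one-out argument. Each null `j` gets
a weight that ignores the sign of `w j`. The FDP is at most `q` times the sum of weights over nulls
with `w j > 0` (`card_filter_selected_div_le`). By invariance this sum has the same expectation as
the one over `w j < 0`, which is pointwise at most 1 (`sum_looWeight_neg_le_one`) because the
leave-one-out thresholds involved all coincide (`threshold_absAt_eq`). -/

/-! ### The threshold and its behaviour under a change of one sign. -/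

lemma exists_threshold_eq_coe {K : ℕ} {q : ℝ} {w : Fin K → ℝ} {x : ℝ}
    (h : threshold q w ≤ (x : WithTop ℝ)) :
    ∃ i, w i ≠ 0 ∧ fdpEstimate w |w i| ≤ q ∧ |w i| ≤ x ∧ threshold q w = (|w i| : ℝ) := by
  obtain ⟨t, ht⟩ : ∃ t : ℝ, threshold q w = t := by
    cases hT : threshold q w with
    | top => rw [hT] at h; simp at h
    | coe t => exact ⟨t, rfl⟩
  have hmem := Finset.mem_of_min ht
  simp only [Finset.mem_filter, Finset.mem_erase, Finset.mem_image, Finset.mem_univ,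
    true_and] at hmem
  obtain ⟨⟨h0, i, rfl⟩, hq⟩ := hmem
  rw [ht] at h
  exact ⟨i, abs_ne_zero.1 h0, hq, WithTop.coe_le_coe.1 h, ht⟩

lemma threshold_le_coe_iff {K : ℕ} {q : ℝ} {w : Fin K → ℝ} {x : ℝ} :
    threshold q w ≤ (x : WithTop ℝ) ↔
      ∃ i, w i ≠ 0 ∧ fdpEstimate w |w i| ≤ q ∧ |w i| ≤ x := by
  refine ⟨fun h => ?_, fun ⟨i, h0, hq, hx⟩ => ?_⟩
  · obtain ⟨i, h0, hq, hx, -⟩ := exists_threshold_eq_coe h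
    exact ⟨i, h0, hq, hx⟩
  · refine le_trans (Finset.min_le ?_) (WithTop.coe_le_coe.2 hx)
    simp only [Finset.mem_filter, Finset.mem_erase, Finset.mem_image, Finset.mem_univ, true_and]
    exact ⟨⟨abs_ne_zero.2 h0, i, rfl⟩, hq⟩

/-- The statistics with the sign of the `j`-th entry made nonnegative. -/
noncomputable def absAt {K : ℕ} (j : Fin K) (w : Fin K → ℝ) : Fin K → ℝ := Function.update w j |w j|

/-- The statistics with the sign of the `j`-th entry flipped. -/
noncomputable def flipAt {K : ℕ} (j : Fin K) (w : Fin K → ℝ) : Fin K → ℝ := Function.update w j (-w j)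

lemma absAt_self {K : ℕ} (j : Fin K) (w : Fin K → ℝ) : absAt j w j = |w j| := by simp [absAt]

lemma absAt_of_ne {K : ℕ} {i j : Fin K} (h : i ≠ j) (w : Fin K → ℝ) : absAt j w i = w i := by
  simp [absAt, h]

lemma absAt_flipAt {K : ℕ} (j : Fin K) (w : Fin K → ℝ) : absAt j (flipAt j w) = absAt j w := by
  simp [absAt, flipAt]

lemma abs_absAt {K : ℕ} (j : Fin K) (w : Fin K → ℝ) (i : Fin K) : |absAt j w i| = |w i| := by
  by_cases h : i = j
  · subst h; simp [absAt]
  · simp [absAt, h]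

lemma absAt_of_nonneg {K : ℕ} {j : Fin K} {w : Fin K → ℝ} (h : 0 ≤ w j) : absAt j w = w := by
  simp [absAt, abs_of_nonneg h]

/-- Turning one of two entries below `-t` into its absolute value leaves the estimated false
discovery proportion at `t` independent of which one is turned. -/
lemma fdpEstimate_absAt_eq {K : ℕ} {w : Fin K → ℝ} {j k : Fin K} {t : ℝ} (ht : 0 < t)
    (hj : w j ≤ -t) (hk : w k ≤ -t) :
    fdpEstimate (absAt j w) t = fdpEstimate (absAt k w) t := by
  have hpos : ∀ l, w l ≤ -t → (Finset.univ.filter fun i => t ≤ absAt l w i) =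
      insert l (Finset.univ.filter fun i => t ≤ w i) := by
    intro l hl
    ext i
    by_cases hi : i = l
    · subst hi
      simp only [Finset.mem_filter, Finset.mem_univ, true_and, Finset.mem_insert, true_or,
        iff_true, absAt_self]
      rw [abs_of_neg (by linarith)]; linarith
    · simp [absAt_of_ne hi, hi]
  have hneg : ∀ l, w l ≤ -t → (Finset.univ.filter fun i => absAt l w i ≤ -t) =
      (Finset.univ.filter fun i => w i ≤ -t).erase l := by
    intro l hl
    ext i
    by_cases hi : i = l
    · subst hi
      simp only [Finset.mem_filter, Finset.mem_univ, true_and, Finset.mem_erase, ne_eq,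
        not_true_eq_false, false_and, iff_false, absAt_self, not_le]
      linarith [abs_nonneg (w i)]
    · simp [absAt_of_ne hi, hi]
  have hc : ∀ l, w l ≤ -t → l ∉ (Finset.univ.filter fun i => t ≤ w i) := by
    intro l hl
    simp only [Finset.mem_filter, Finset.mem_univ, true_and, not_le]
    linarith
  unfold fdpEstimate
  rw [hpos j hj, hpos k hk, hneg j hj, hneg k hk, Finset.card_insert_of_notMem (hc j hj),
    Finset.card_insert_of_notMem (hc k hk), Finset.card_erase_of_mem (by simpa using hj),
    Finset.card_erase_of_mem (by simpa using hk)]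

/-- The threshold `t` of `absAt j w` is at most both `-w j` and `-w k`, so `fdpEstimate_absAt_eq`
applies at `t`; hence `t` is also a candidate for `absAt k w`. -/
lemma threshold_absAt_le {K : ℕ} {q : ℝ} {w : Fin K → ℝ} {j k : Fin K} {s : ℝ}
    (hj : threshold q (absAt j w) ≤ ((-w j : ℝ) : WithTop ℝ))
    (hs : s ≤ -w k)
    (hjk : threshold q (absAt j w) ≤ s) :
    threshold q (absAt k w) ≤ threshold q (absAt j w) := by
  obtain ⟨i, h0, hq, hx, hT⟩ := exists_threshold_eq_coe hj
  rw [hT, WithTop.coe_le_coe] at hjk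
  rw [hT, threshold_le_coe_iff]
  rw [abs_absAt] at hq hx hjk ⊢
  have h0' : w i ≠ 0 := by rw [← abs_ne_zero, ← abs_absAt j w i, abs_ne_zero]; exact h0
  refine ⟨i, ?_, ?_, (abs_absAt k w i).le⟩
  · rw [← abs_ne_zero, abs_absAt, abs_ne_zero]; exact h0'
  · rw [abs_absAt, ← fdpEstimate_absAt_eq (j := j) (abs_pos.2 h0') (by linarith) (by linarith)]
    exact hq

/-- The smaller of the two thresholds lies below both `-w j` and `-w k`, so it is a candidate for
the other vector too. -/
lemma threshold_absAt_eq {K : ℕ} {q : ℝ} {w : Fin K → ℝ} {j k : Fin K}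
    (hj : threshold q (absAt j w) ≤ ((-w j : ℝ) : WithTop ℝ))
    (hk : threshold q (absAt k w) ≤ ((-w k : ℝ) : WithTop ℝ)) :
    threshold q (absAt j w) = threshold q (absAt k w) := by
  obtain ⟨_, _, _, hxj, hTj⟩ := exists_threshold_eq_coe hj
  obtain ⟨_, _, _, hxk, hTk⟩ := exists_threshold_eq_coe hk
  rcases le_total (threshold q (absAt j w)) (threshold q (absAt k w)) with h | h
  · exact le_antisymm h (threshold_absAt_le hj hxk (h.trans hTk.le))
  · exact le_antisymm (threshold_absAt_le hk hxj (h.trans hTj.le)) h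

/-! ### Leave-one-out weights. -/

open Classical in
/-- One plus the number of `k ∈ N`, `k ≠ j`, with `w k` below minus the threshold of
`absAt j w`. -/
noncomputable def looCount {K : ℕ} (q : ℝ) (N : Finset (Fin K)) (j : Fin K) (w : Fin K → ℝ) : ℝ :=
  1 + ∑ k ∈ N.erase j, if threshold q (absAt j w) ≤ ((-w k : ℝ) : WithTop ℝ) then 1 else 0

open Classical in
/-- The contribution of index `j` to the leave-one-out bound of the false discovery proportion,
a function of `w` that does not depend on the sign of `w j`. -/
noncomputable def looWeight {K : ℕ} (q : ℝ) (N : Finset (Fin K)) (j : Fin K) (w : Fin K → ℝ) : ℝ :=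
  if threshold q (absAt j w) ≤ ((|w j| : ℝ) : WithTop ℝ) then (looCount q N j w)⁻¹ else 0

lemma one_le_looCount {K : ℕ} (q : ℝ) (N : Finset (Fin K)) (j : Fin K) (w : Fin K → ℝ) :
    1 ≤ looCount q N j w := by
  unfold looCount
  have : 0 ≤ ∑ k ∈ N.erase j,
      (if threshold q (absAt j w) ≤ ((-w k : ℝ) : WithTop ℝ) then (1 : ℝ) else 0) :=
    Finset.sum_nonneg fun k _ => by split_ifs <;> norm_num
  linarith

lemma looWeight_nonneg {K : ℕ} (q : ℝ) (N : Finset (Fin K)) (j : Fin K) (w : Fin K → ℝ) :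
    0 ≤ looWeight q N j w := by
  unfold looWeight
  split_ifs
  · exact inv_nonneg.2 (zero_le_one.trans (one_le_looCount q N j w))
  · exact le_rfl

lemma looWeight_le_one {K : ℕ} (q : ℝ) (N : Finset (Fin K)) (j : Fin K) (w : Fin K → ℝ) :
    looWeight q N j w ≤ 1 := by
  unfold looWeight
  split_ifs
  · exact inv_le_one_of_one_le₀ (one_le_looCount q N j w)
  · exact zero_le_one

lemma looWeight_flipAt {K : ℕ} (q : ℝ) (N : Finset (Fin K)) (j : Fin K) (w : Fin K → ℝ) :
    looWeight q N j (flipAt j w) = looWeight q N j w := by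
  have h : looCount q N j (flipAt j w) = looCount q N j w := by
    unfold looCount
    rw [absAt_flipAt]
    congr 1
    refine Finset.sum_congr rfl fun k hk => ?_
    rw [flipAt, Function.update_of_ne (Finset.ne_of_mem_erase hk)]
  unfold looWeight
  rw [h, absAt_flipAt]
  simp [flipAt]

lemma looCount_eq_card {K : ℕ} {q : ℝ} {N : Finset (Fin K)} {j : Fin K} {w : Fin K → ℝ} {t : ℝ}
    (ht : threshold q (absAt j w) = t) :
    looCount q N j w = 1 + (((N.erase j).filter fun k => w k ≤ -t).card : ℝ) := by
  unfold looCount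
  simp only [ht, WithTop.coe_le_coe, Finset.card_filter, le_neg (a := t)]
  push_cast
  rfl

/-- The false discovery proportion is at most `q` times the sum of the leave-one-out weights of
the null indices with positive statistic. -/
lemma card_filter_selected_div_le {K : ℕ} {q : ℝ} (hq : 0 ≤ q) (N : Finset (Fin K))
    (w : Fin K → ℝ) :
    (((selected q w).filter (· ∈ N)).card : ℝ) / max ((selected q w).card : ℝ) 1 ≤
      q * ∑ j ∈ N, if 0 < w j then looWeight q N j w else 0 := by
  have hsum : ∀ j ∈ N, 0 ≤ if 0 < w j then looWeight q N j w else 0 := fun j _ => by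
    split_ifs
    · exact looWeight_nonneg q N j w
    · exact le_rfl
  rcases (selected q w).eq_empty_or_nonempty with he | ⟨l, hl⟩
  · rw [he]
    simpa using mul_nonneg hq (Finset.sum_nonneg hsum)
  simp only [selected, Finset.mem_filter, Finset.mem_univ, true_and] at hl
  obtain ⟨i, h0, hest, -, hT⟩ := exists_threshold_eq_coe hl
  have htpos : 0 < |w i| := abs_pos.2 h0
  generalize |w i| = t at hest hT htpos
  have hsel : selected q w = Finset.univ.filter fun k => t ≤ w k := by
    unfold selected
    rw [hT]
    simp only [WithTop.coe_le_coe]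
  unfold fdpEstimate at hest
  rw [← hsel] at hest
  set c : ℝ := ((Finset.univ.filter fun k => w k ≤ -t).card : ℝ) with hc
  have hcnn : 0 ≤ c := Nat.cast_nonneg _
  set m : ℝ := max ((selected q w).card : ℝ) 1
  have hm : 0 < m := lt_max_of_lt_right one_pos
  have hw : ∀ j ∈ (selected q w).filter (· ∈ N),
      (1 + c)⁻¹ ≤ if 0 < w j then looWeight q N j w else 0 := by
    intro j hj
    rw [hsel, Finset.filter_filter] at hj
    simp only [Finset.mem_filter, Finset.mem_univ, true_and] at hj
    have hjpos : 0 < w j := htpos.trans_le hj.1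
    rw [if_pos hjpos]
    unfold looWeight
    -- For a selected index the leave-one-out threshold is the actual one, as `w j` is already
    -- positive.
    have hTj : threshold q (absAt j w) = t := by rw [absAt_of_nonneg hjpos.le, hT]
    rw [if_pos (by rw [hTj, abs_of_pos hjpos]; exact WithTop.coe_le_coe.2 hj.1),
      looCount_eq_card hTj]
    refine inv_anti₀ (by positivity) ?_
    rw [add_le_add_iff_left, hc, Nat.cast_le]
    exact Finset.card_le_card (Finset.filter_subset_filter _ (Finset.subset_univ _))
  calc (((selected q w).filter (· ∈ N)).card : ℝ) / m
      ≤ q * ((((selected q w).filter (· ∈ N)).card : ℝ) * (1 + c)⁻¹) := by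
        -- The threshold passes its own test, which now reads `1 + c ≤ q * m`.
        rw [div_le_iff₀ hm] at hest ⊢
        have h1 : (0 : ℝ) ≤ ((selected q w).filter (· ∈ N)).card * (1 + c)⁻¹ := by positivity
        calc (((selected q w).filter (· ∈ N)).card : ℝ)
            = (((selected q w).filter (· ∈ N)).card * (1 + c)⁻¹) * (1 + c) := by
              field_simp
          _ ≤ (((selected q w).filter (· ∈ N)).card * (1 + c)⁻¹) * (q * m) := by gcongr
          _ = _ := by ring
    _ ≤ q * ∑ j ∈ (selected q w).filter (· ∈ N), if 0 < w j then looWeight q N j w else 0 := by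
        gcongr
        rw [← nsmul_eq_mul, ← Finset.sum_const]
        exact Finset.sum_le_sum hw
    _ ≤ _ := by
        refine mul_le_mul_of_nonneg_left ?_ hq
        exact Finset.sum_le_sum_of_subset_of_nonneg (fun j hj => (Finset.mem_filter.1 hj).2)
          fun j hj _ => hsum j hj

/-- The leave-one-out weights of the indices with negative statistic add up to at most one. -/
lemma sum_looWeight_neg_le_one {K : ℕ} (q : ℝ) (N : Finset (Fin K)) (w : Fin K → ℝ) :
    (∑ j ∈ N, if w j < 0 then looWeight q N j w else 0) ≤ 1 := by
  classical
  -- Exactly the indices of `J` contribute. They share one threshold, so each counts all the others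
  -- and has weight at most `1 / |J|`.
  set J := N.filter fun j => w j < 0 ∧ threshold q (absAt j w) ≤ ((-w j : ℝ) : WithTop ℝ) with hJ
  have hJw : ∀ j ∈ J, (looCount q N j w)⁻¹ ≤ (J.card : ℝ)⁻¹ := by
    intro j hj
    have hj' := (Finset.mem_filter.1 hj).2
    obtain ⟨_, _, _, -, hT⟩ := exists_threshold_eq_coe hj'.2
    refine inv_anti₀ (by exact_mod_cast Finset.card_pos.2 ⟨j, hj⟩) ?_
    rw [looCount_eq_card hT, ← Finset.card_erase_add_one hj]
    push_cast
    rw [add_comm]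
    gcongr
    intro k hk
    have hkJ := Finset.mem_filter.1 (Finset.mem_of_mem_erase hk)
    refine Finset.mem_filter.2
      ⟨Finset.mem_erase.2 ⟨Finset.ne_of_mem_erase hk, hkJ.1⟩, ?_⟩
    have := hkJ.2.2
    rw [← threshold_absAt_eq hj'.2 hkJ.2.2, hT, WithTop.coe_le_coe] at this
    linarith
  calc (∑ j ∈ N, if w j < 0 then looWeight q N j w else 0)
      = ∑ j ∈ J, (looCount q N j w)⁻¹ := by
        rw [hJ, Finset.sum_filter]
        refine Finset.sum_congr rfl fun j _ => ?_
        by_cases h : w j < 0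
        · simp [h, looWeight, abs_of_neg h]
        · simp [h]
    _ ≤ ∑ _j ∈ J, (J.card : ℝ)⁻¹ := Finset.sum_le_sum hJw
    _ ≤ 1 := by
        rw [Finset.sum_const, nsmul_eq_mul]
        -- This includes empty `J`, where `0 * 0⁻¹ = 0`.
        exact mul_inv_le_one

/-! ### Measurability. -/

lemma measurable_absAt {K : ℕ} (j : Fin K) : Measurable (absAt j : (Fin K → ℝ) → Fin K → ℝ) := by
  refine measurable_pi_lambda _ fun i => ?_
  by_cases h : i = j
  · subst h
    simpa [absAt] using (measurable_pi_apply i).abs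
  · simpa [absAt, h] using measurable_pi_apply i

lemma measurable_flipAt {K : ℕ} (j : Fin K) :
    Measurable (flipAt j : (Fin K → ℝ) → Fin K → ℝ) := by
  refine measurable_pi_lambda _ fun i => ?_
  by_cases h : i = j
  · subst h
    simp only [flipAt, Function.update_self]
    exact (measurable_pi_apply i).neg
  · simpa [flipAt, h] using measurable_pi_apply i

lemma measurable_fdpEstimate {K : ℕ} {f : (Fin K → ℝ) → ℝ} (hf : Measurable f) :
    Measurable fun w => fdpEstimate w (f w) := by
  unfold fdpEstimate
  simp only [Finset.card_filter]
  push_cast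
  refine Measurable.div (measurable_const.add (Finset.measurable_sum _ fun i _ => ?_))
    (Measurable.max (Finset.measurable_sum _ fun i _ => ?_) measurable_const)
  · exact Measurable.ite (measurableSet_le (measurable_pi_apply i) hf.neg) measurable_const
      measurable_const
  · exact Measurable.ite (measurableSet_le hf (measurable_pi_apply i)) measurable_const
      measurable_const

lemma measurableSet_threshold_le {K : ℕ} (q : ℝ) {f : (Fin K → ℝ) → ℝ} (hf : Measurable f) :
    MeasurableSet {w : Fin K → ℝ | threshold q w ≤ (f w : WithTop ℝ)} := by
  simp only [threshold_le_coe_iff, Set.ofPred_exists]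
  refine MeasurableSet.iUnion fun i => ?_
  have hi : Measurable fun w : Fin K → ℝ => w i := measurable_pi_apply i
  refine ((hi (measurableSet_singleton 0)).compl).inter
    ((measurableSet_le (measurable_fdpEstimate hi.abs) measurable_const).inter
      (measurableSet_le hi.abs hf))

lemma measurableSet_threshold_absAt_le {K : ℕ} (q : ℝ) (j : Fin K) {f : (Fin K → ℝ) → ℝ}
    (hf : Measurable f) :
    MeasurableSet {w : Fin K → ℝ | threshold q (absAt j w) ≤ (f w : WithTop ℝ)} := by
  simp only [threshold_le_coe_iff, Set.ofPred_exists]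
  refine MeasurableSet.iUnion fun i => ?_
  have hi : Measurable fun w : Fin K → ℝ => absAt j w i :=
    (measurable_pi_apply i).comp (measurable_absAt j)
  have he : Measurable fun w : Fin K → ℝ => fdpEstimate (absAt j w) |absAt j w i| :=
    (measurable_fdpEstimate (measurable_pi_apply i).abs).comp (measurable_absAt j)
  exact ((hi (measurableSet_singleton 0)).compl).inter
    ((measurableSet_le he measurable_const).inter (measurableSet_le hi.abs hf))

lemma measurable_looWeight {K : ℕ} (q : ℝ) (N : Finset (Fin K)) (j : Fin K) :
    Measurable (looWeight q N j) := by
  classical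
  unfold looWeight looCount
  refine Measurable.ite (measurableSet_threshold_absAt_le q j (measurable_pi_apply j).abs)
    (Measurable.inv (measurable_const.add (Finset.measurable_sum _ fun k _ => ?_)))
    measurable_const
  exact Measurable.ite (measurableSet_threshold_absAt_le q j (measurable_pi_apply k).neg)
    measurable_const measurable_const

lemma measurable_card_filter_selected_div {K : ℕ} (q : ℝ) (N : Finset (Fin K)) :
    Measurable fun w : Fin K → ℝ =>
      (((selected q w).filter (· ∈ N)).card : ℝ) / max ((selected q w).card : ℝ) 1 := by
  classical
  unfold selected
  simp only [Finset.filter_filter, Finset.card_filter]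
  push_cast
  refine Measurable.div (Finset.measurable_sum _ fun i _ => ?_)
    (Measurable.max (Finset.measurable_sum _ fun i _ => ?_) measurable_const)
  · exact Measurable.ite ((measurableSet_threshold_le q (measurable_pi_apply i)).inter
      (MeasurableSet.const _)) measurable_const measurable_const
  · exact Measurable.ite (measurableSet_threshold_le q (measurable_pi_apply i))
      measurable_const measurable_const

/-! ### FDR control from invariance under single sign flips. -/

lemma card_filter_div_max_mem_Icc {ι : Type*} (S : Finset ι) (p : ι → Prop) [DecidablePred p] :
    ((S.filter p).card : ℝ) / max (S.card : ℝ) 1 ∈ Set.Icc (0 : ℝ) 1 := by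
  refine ⟨by positivity, div_le_one_of_le₀ (le_max_of_le_left ?_) (by positivity)⟩
  exact_mod_cast Finset.card_filter_le _ _

/-- **Knockoff+ controls the false discovery rate** for statistics whose law is invariant under
the sign flip of each single null statistic. -/
theorem integral_card_filter_selected_div_le {K : ℕ} {q : ℝ} (hq : 0 ≤ q) (N : Finset (Fin K))
    (ρ : Measure (Fin K → ℝ)) [IsProbabilityMeasure ρ]
    (hρ : ∀ j ∈ N, MeasurePreserving (flipAt j) ρ ρ) :
    ∫ w, (((selected q w).filter (· ∈ N)).card : ℝ) / max ((selected q w).card : ℝ) 1 ∂ρ ≤ q := by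
  have hposm : ∀ j, Measurable fun w : Fin K → ℝ => if 0 < w j then looWeight q N j w else 0 :=
    fun j => Measurable.ite (measurableSet_lt measurable_const (measurable_pi_apply j))
      (measurable_looWeight q N j) measurable_const
  have hnegm : ∀ j, Measurable fun w : Fin K → ℝ => if w j < 0 then looWeight q N j w else 0 :=
    fun j => Measurable.ite (measurableSet_lt (measurable_pi_apply j) measurable_const)
      (measurable_looWeight q N j) measurable_const
  have hbound : ∀ (j : Fin K) (P : Prop) [Decidable P] (w : Fin K → ℝ),
      ‖if P then looWeight q N j w else 0‖ ≤ 1 := by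
    intro j P _ w
    split_ifs
    · rw [Real.norm_of_nonneg (looWeight_nonneg q N j w)]
      exact looWeight_le_one q N j w
    · simp
  have hposi : ∀ j, Integrable (fun w => if 0 < w j then looWeight q N j w else 0) ρ := fun j =>
    Integrable.of_bound (hposm j).aestronglyMeasurable 1 (.of_forall fun w => hbound j _ w)
  have hnegi : ∀ j, Integrable (fun w => if w j < 0 then looWeight q N j w else 0) ρ := fun j =>
    Integrable.of_bound (hnegm j).aestronglyMeasurable 1 (.of_forall fun w => hbound j _ w)
  -- The flip preserves the weight and exchanges the events `0 < w j` and `w j < 0`.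
  have hflip : ∀ j ∈ N, ∫ w, (if 0 < w j then looWeight q N j w else 0) ∂ρ =
      ∫ w, (if w j < 0 then looWeight q N j w else 0) ∂ρ := by
    intro j hj
    have h := integral_map (μ := ρ) (measurable_flipAt j).aemeasurable
      (f := fun w => if 0 < w j then looWeight q N j w else 0) (hposm j).aestronglyMeasurable
    rw [(hρ j hj).map_eq] at h
    rw [h]
    refine integral_congr_ae (.of_forall fun w => ?_)
    simp only [looWeight_flipAt]
    simp [flipAt]
  calc ∫ w, (((selected q w).filter (· ∈ N)).card : ℝ) / max ((selected q w).card : ℝ) 1 ∂ρ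
      ≤ ∫ w, q * ∑ j ∈ N, (if 0 < w j then looWeight q N j w else 0) ∂ρ := by
        refine integral_mono ?_ ((integrable_finsetSum _ fun j _ => hposi j).const_mul q)
          fun w => card_filter_selected_div_le hq N w
        refine Integrable.of_bound (measurable_card_filter_selected_div q N).aestronglyMeasurable 1
          (.of_forall fun w => ?_)
        have := card_filter_div_max_mem_Icc (selected q w) (· ∈ N)
        rw [Real.norm_of_nonneg this.1]
        exact this.2
    _ = q * ∫ w, ∑ j ∈ N, (if w j < 0 then looWeight q N j w else 0) ∂ρ := by
        rw [integral_const_mul, integral_finsetSum _ fun j _ => hposi j,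
          integral_finsetSum _ fun j _ => hnegi j, Finset.sum_congr rfl hflip]
    _ ≤ q * ∫ _w, (1 : ℝ) ∂ρ := by
        gcongr
        · exact integrable_finsetSum _ fun j _ => hnegi j
        · exact integrable_const _
        · exact fun w => sum_looWeight_neg_le_one q N w
    _ = q := by simp

/-! ### Gaussian reflections and sign flips of null statistics. -/

open scoped RealInnerProductSpace in
/-- The law of a centred Gaussian vector with independent entries of equal variance is invariant
under linear isometries. -/
lemma measurePreserving_pi_gaussianReal {n : ℕ} (v : NNReal)
    (f : EuclideanSpace ℝ (Fin n) ≃ₗᵢ[ℝ] EuclideanSpace ℝ (Fin n)) :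
    MeasurePreserving (fun x : Fin n → ℝ => (f (WithLp.toLp 2 x)).ofLp)
      (Measure.pi fun _ => gaussianReal 0 v) (Measure.pi fun _ => gaussianReal 0 v) := by
  set γ : Measure (Fin n → ℝ) := Measure.pi fun _ => gaussianReal 0 v
  set γE : Measure (EuclideanSpace ℝ (Fin n)) := γ.map (WithLp.toLp 2) with hγE
  have hto : Measurable (WithLp.toLp 2 : (Fin n → ℝ) → EuclideanSpace ℝ (Fin n)) := by fun_prop
  have hof : Measurable (WithLp.ofLp : EuclideanSpace ℝ (Fin n) → Fin n → ℝ) := by fun_prop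
  have hf : Measurable f := f.continuous.measurable
  have : IsProbabilityMeasure γE := Measure.isProbabilityMeasure_map hto.aemeasurable
  have hchar : ∀ t, charFun γE t = Complex.exp (-(v * ‖t‖ ^ 2 / 2 : ℝ)) := by
    intro t
    rw [hγE, charFun_pi]
    simp_rw [charFun_gaussianReal, ← Complex.exp_sum, EuclideanSpace.real_norm_sq_eq]
    congr 1
    push_cast
    rw [Finset.mul_sum, Finset.sum_div, ← Finset.sum_neg_distrib]
    refine Finset.sum_congr rfl fun i _ => ?_
    simp
  have hmap : γE.map f = γE := by
    have : IsProbabilityMeasure (γE.map f) := Measure.isProbabilityMeasure_map hf.aemeasurable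
    refine Measure.ext_of_charFun ?_
    ext t
    have h : charFun (γE.map f) t = charFun γE (f.symm t) := by
      rw [charFun_apply, charFun_apply, integral_map hf.aemeasurable (by fun_prop)]
      refine integral_congr_ae (.of_forall fun x => ?_)
      simp only
      rw [← f.inner_map_map x (f.symm t), f.apply_symm_apply]
    rw [h, hchar, hchar, f.symm.norm_map]
  refine ⟨hof.comp (hf.comp hto), ?_⟩
  change γ.map (WithLp.ofLp ∘ (f ∘ WithLp.toLp 2)) = γ
  rw [← Measure.map_map hof (hf.comp hto), ← Measure.map_map hf hto, ← hγE, hmap, hγE,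
    Measure.map_map hof hto]
  exact Measure.map_id

/-- For two vectors of equal length there is a reflection that swaps them, fixes all vectors
orthogonal to their difference and preserves every isotropic centred Gaussian law. -/
lemma exists_reflection_swap {n : ℕ} {a b : Fin n → ℝ} (hab : a ⬝ᵥ a = b ⬝ᵥ b) :
    ∃ R : (Fin n → ℝ) →ₗ[ℝ] (Fin n → ℝ),
      (∀ v : NNReal, MeasurePreserving R (Measure.pi fun _ => gaussianReal 0 v)
        (Measure.pi fun _ => gaussianReal 0 v)) ∧
      (∀ u x, R u ⬝ᵥ x = u ⬝ᵥ R x) ∧ (∀ u, R (R u) = u) ∧ R a = b ∧ R b = a ∧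
      ∀ u, u ⬝ᵥ a = u ⬝ᵥ b → R u = u := by
  have hinner : ∀ x y : EuclideanSpace ℝ (Fin n), inner ℝ x y = x.ofLp ⬝ᵥ y.ofLp := fun x y => by
    rw [EuclideanSpace.inner_eq_star_dotProduct, dotProduct_comm]
    simp
  set a' : EuclideanSpace ℝ (Fin n) := WithLp.toLp 2 a
  set b' : EuclideanSpace ℝ (Fin n) := WithLp.toLp 2 b
  -- For `a = b` this is the identity, so no separate case is needed.
  set f := (Submodule.span ℝ {a' - b'})ᗮ.reflection with hf
  have hff : ∀ x, f (f x) = x := Submodule.reflection_reflection _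
  have hnorm : ‖a'‖ = ‖b'‖ := by
    rw [← sq_eq_sq₀ (norm_nonneg _) (norm_nonneg _), ← real_inner_self_eq_norm_sq,
      ← real_inner_self_eq_norm_sq, hinner, hinner]
    exact hab
  have hfa : f a' = b' := Submodule.reflection_sub hnorm
  let e := WithLp.linearEquiv 2 ℝ (Fin n → ℝ)
  refine ⟨e.toLinearMap ∘ₗ f.toLinearEquiv.toLinearMap ∘ₗ e.symm.toLinearMap,
    fun v => measurePreserving_pi_gaussianReal v f, fun u x => ?_, fun u => ?_, ?_, ?_,
    fun u hu => ?_⟩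
  · have h := f.inner_map_map (WithLp.toLp 2 u) (f (WithLp.toLp 2 x))
    rw [hff, hinner, hinner] at h
    exact h
  · change (f (f (WithLp.toLp 2 u))).ofLp = u
    rw [hff]
  · change (f a').ofLp = b
    rw [hfa]
  · change (f b').ofLp = a
    rw [← hfa, hff]
  · change (f (WithLp.toLp 2 u)).ofLp = u
    rw [hf, Submodule.reflection_mem_subspace_eq_self]
    rw [Submodule.mem_orthogonal_singleton_iff_inner_left, inner_sub_right, hinner, hinner]
    exact sub_eq_zero.2 hu

/-- If a symmetric involution `R` maps the columns of `[A B]` to those of `[A' B']`, then the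
statistic of `[A' B']` at `z` is the statistic of `[A B]` at `R z`. -/
lemma IsKnockoffStatistic.apply_eq_of_col_eq {n K : ℕ}
    {W : Matrix (Fin n) (Fin K) ℝ → Matrix (Fin n) (Fin K) ℝ → (Fin n → ℝ) → Fin K → ℝ}
    (hW : IsKnockoffStatistic W) {R : (Fin n → ℝ) → (Fin n → ℝ)}
    (hsymm : ∀ u x, R u ⬝ᵥ x = u ⬝ᵥ R x) (hinv : ∀ u, R (R u) = u)
    {A B A' B' : Matrix (Fin n) (Fin K) ℝ} (hA : ∀ k, A'.col k = R (A.col k))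
    (hB : ∀ k, B'.col k = R (B.col k)) (z : Fin n → ℝ) :
    W A' B' z = W A B (R z) := by
  obtain ⟨f, hf⟩ := hW.sufficiency
  have hcol : ∀ c, (Matrix.fromCols A' B').col c = R ((Matrix.fromCols A B).col c) := by
    rintro (k | k)
    · exact hA k
    · exact hB k
  rw [hf, hf]
  congr 1
  · ext c d
    change (Matrix.fromCols A' B').col c ⬝ᵥ (Matrix.fromCols A' B').col d =
      (Matrix.fromCols A B).col c ⬝ᵥ (Matrix.fromCols A B).col d
    rw [hcol, hcol, hsymm, hinv]
  · ext c
    change (Matrix.fromCols A' B').col c ⬝ᵥ z = (Matrix.fromCols A B).col c ⬝ᵥ R z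
    rw [hcol, hsymm]

lemma IsKnockoff.col_dotProduct {n p : ℕ} {X Xk : Matrix (Fin n) (Fin p) ℝ} (h : IsKnockoff X Xk) :
    (∀ i j, Xk.col i ⬝ᵥ Xk.col j = X.col i ⬝ᵥ X.col j) ∧
      ∀ i j, i ≠ j → X.col i ⬝ᵥ Xk.col j = X.col i ⬝ᵥ X.col j := by
  obtain ⟨s, -, h1, h2⟩ := h
  refine ⟨fun i j => congrFun (congrFun h1 i) j, fun i j hij => ?_⟩
  have := congrFun (congrFun h2 i) j
  rw [Matrix.sub_apply, Matrix.diagonal_apply_ne _ hij, sub_zero] at this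
  exact this

/-- The difference of column `j` and its knockoff is orthogonal to every other column of the full
`X`, prototype or not. This is why the relevant nulls are those of the full model. -/
lemma IsKnockoff.mulVec_dotProduct_col {n p : ℕ} {X Xk : Matrix (Fin n) (Fin p) ℝ}
    (h : IsKnockoff X Xk) {β : Fin p → ℝ} {j : Fin p} (hj : β j = 0) :
    X.mulVec β ⬝ᵥ X.col j = X.mulVec β ⬝ᵥ Xk.col j := by
  have hX : X.mulVec β = ∑ i, β i • X.col i := by
    ext r
    simp [Matrix.mulVec, dotProduct, mul_comm]
  rw [hX, sum_dotProduct, sum_dotProduct]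
  refine Finset.sum_congr rfl fun i _ => ?_
  by_cases hi : i = j
  · simp [hi, hj]
  · rw [smul_dotProduct, smul_dotProduct, h.col_dotProduct.2 i j hi]

/-- The law of the statistics of the reduced pair of matrices is invariant under the sign flip of
each null statistic. -/
lemma measurePreserving_flipAt_statistic {n p K : ℕ} {X Xk : Matrix (Fin n) (Fin p) ℝ}
    (h : IsKnockoff X Xk) {β : Fin p → ℝ} {P : Fin K → Fin p} (hP : Function.Injective P)
    {W : Matrix (Fin n) (Fin K) ℝ → Matrix (Fin n) (Fin K) ℝ → (Fin n → ℝ) → Fin K → ℝ}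
    (hW : IsKnockoffStatistic W) (v : NNReal) {k : Fin K} (hk : β (P k) = 0) :
    MeasurePreserving (flipAt k)
      ((Measure.pi fun _ => gaussianReal 0 v).map fun e =>
        W (reduceCols X P) (reduceCols Xk P) (X.mulVec β + e))
      ((Measure.pi fun _ => gaussianReal 0 v).map fun e =>
        W (reduceCols X P) (reduceCols Xk P) (X.mulVec β + e)) := by
  set A := reduceCols X P with hA
  set B := reduceCols Xk P with hB
  set m := X.mulVec β with hm
  obtain ⟨R, hR, hsymm, hinv, hRa, hRb, hfix⟩ :=
    exists_reflection_swap (h.col_dotProduct.1 (P k) (P k)).symm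
  have hcomm : ∀ i j, i ≠ j → Xk.col i ⬝ᵥ X.col j = X.col i ⬝ᵥ X.col j := fun i j hij => by
    rw [dotProduct_comm, h.col_dotProduct.2 j i hij.symm, dotProduct_comm]
  have hflip : ∀ e, W A B (m + R e) = flipAt k (W A B (m + e)) := by
    intro e
    have hz : m + R e = R (m + e) := by rw [map_add, hfix m (h.mulVec_dotProduct_col hk)]
    rw [hz, ← hW.apply_eq_of_col_eq hsymm hinv (A' := exchange {k} A B)
      (B' := exchange {k} B A) ?_ ?_]
    · ext i
      rw [hW.antisymmetry]
      by_cases hi : i = k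
      · subst hi; simp [flipAt]
      · simp [flipAt, hi]
    · intro i
      by_cases hi : i = k
      · subst hi
        have : (exchange {i} A B).col i = Xk.col (P i) := by
          ext r; simp [exchange, hB, reduceCols]
        rw [this, ← hRa]; rfl
      · have : (exchange {k} A B).col i = X.col (P i) := by
          ext r; simp [exchange, hA, reduceCols, hi]
        rw [this]
        -- Distinct prototypes are distinct columns, so the reflection for `P k` fixes this one.
        exact (hfix _ (h.col_dotProduct.2 _ _ (hP.ne hi)).symm).symm
    · intro i
      by_cases hi : i = k
      · subst hi
        have : (exchange {i} B A).col i = X.col (P i) := by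
          ext r; simp [exchange, hA, reduceCols]
        rw [this, ← hRb]; rfl
      · have : (exchange {k} B A).col i = Xk.col (P i) := by
          ext r; simp [exchange, hB, reduceCols, hi]
        rw [this]
        exact (hfix _ ((hcomm _ _ (hP.ne hi)).trans (h.col_dotProduct.1 _ _).symm)).symm
  have hw : Measurable fun e => W A B (m + e) := (hW.measurable A B).comp (measurable_const_add m)
  refine ⟨measurable_flipAt k, ?_⟩
  rw [Measure.map_map (measurable_flipAt k) hw]
  -- Replacing the noise `e` by `R e` leaves its law unchanged and flips the statistic.
  conv_rhs => rw [← (hR v).map_eq, Measure.map_map hw (hR v).measurable]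
  congr 1
  ext e : 1
  exact (hflip e).symm

/-! ### Prototypes and measurability of the realised FDP. -/

lemma IsPrototypeRule.injective {n p K : ℕ} {X : Matrix (Fin n) (Fin p) ℝ}
    {C : Fin K → Finset (Fin p)} (hC : IsClustering C) {proto : (Fin n → ℝ) → Fin K → Fin p}
    (h : IsPrototypeRule X C proto) (y : Fin n → ℝ) : Function.Injective (proto y) := by
  intro k l hkl
  by_contra hne
  exact Finset.disjoint_left.1 (hC.disjoint k l hne) (h.mem y k) (hkl ▸ h.mem y l)

lemma fdp_mem_Icc {p K : ℕ} (β : Fin p → ℝ) (P : Fin K → Fin p) (S : Finset (Fin K)) :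
    fdp β P S ∈ Set.Icc (0 : ℝ) 1 := card_filter_div_max_mem_Icc S _

lemma fdp_eq {p K : ℕ} (β : Fin p → ℝ) (P : Fin K → Fin p) (S : Finset (Fin K)) :
    fdp β P S =
      ((S.filter (· ∈ Finset.univ.filter fun k => β (P k) = 0)).card : ℝ) /
        max (S.card : ℝ) 1 := by
  simp [fdp]

/-- Prototype vectors range over a finite type, so measurability for each fixed `P` is enough;
nothing is needed about how `W` varies with `P`. -/
lemma measurable_fdp_selected {n p K : ℕ}
    {W : (Fin K → Fin p) → (Fin n → ℝ) → Fin K → ℝ} (hW : ∀ P, Measurable (W P))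
    (β : Fin p → ℝ) (q : ℝ) :
    Measurable fun x : (Fin K → Fin p) × (Fin n → ℝ) => fdp β x.1 (selected q (W x.1 x.2)) := by
  refine measurable_from_prod_countable_right fun P => ?_
  simp only [fdp_eq]
  exact (measurable_card_filter_selected_div q _).comp (hW P)

lemma measurable_fdp_procedureStat {n₁ n₂ p K : ℕ} (X₂ Xk₂ : Matrix (Fin n₂) (Fin p) ℝ)
    {proto : (Fin n₁ → ℝ) → Fin K → Fin p} (hproto : Measurable proto)
    {W : Matrix (Fin n₂) (Fin K) ℝ → Matrix (Fin n₂) (Fin K) ℝ → (Fin n₂ → ℝ) → Fin K → ℝ}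
    (hW : IsKnockoffStatistic W) (β : Fin p → ℝ) (q : ℝ) :
    Measurable fun y : Fin n₁ ⊕ Fin n₂ → ℝ =>
      fdp β (proto (y ∘ Sum.inl)) (selected q (procedureStat X₂ Xk₂ proto W y)) := by
  have h1 : Measurable fun y : Fin n₁ ⊕ Fin n₂ → ℝ => y ∘ Sum.inl :=
    measurable_pi_lambda _ fun _ => measurable_pi_apply _
  have h2 : Measurable fun y : Fin n₁ ⊕ Fin n₂ → ℝ => y ∘ Sum.inr :=
    measurable_pi_lambda _ fun _ => measurable_pi_apply _
  have h := (measurable_fdp_selected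
    (fun P => hW.measurable (reduceCols X₂ P) (reduceCols Xk₂ P)) β q).comp
    ((hproto.comp h1).prodMk h2)
  simp only [Function.comp_def] at h
  unfold procedureStat
  simp only [Function.comp_def]
  exact h

end Protolasso

/-! ### Conditioning on the first half of the data. -/

theorem mainTheorem1 {Ω : Type*} [MeasurableSpace Ω] (μ : Measure Ω) [IsProbabilityMeasure μ]
    {n₁ n₂ p K : ℕ}
    -- the fixed design, split by rows, and the linear model `y = X β + ε`
    (X : Matrix (Fin n₁ ⊕ Fin n₂) (Fin p) ℝ) (β : Fin p → ℝ) (σ : NNReal)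
    (ε y : Ω → Fin n₁ ⊕ Fin n₂ → ℝ)
    (hε_law : ∀ i, HasLaw (fun ω => ε ω i) (gaussianReal 0 (σ ^ 2)) μ)
    (hε_indep : iIndepFun (fun i ω => ε ω i) μ)
    (hy : ∀ ω, y ω = X.mulVec β + ε ω)
    -- clustering of the columns and prototypes from the first half of the data
    (C : Fin K → Finset (Fin p)) (hC : Protolasso.IsClustering C)
    (proto : (Fin n₁ → ℝ) → Fin K → Fin p)
    (hproto : Protolasso.IsPrototypeRule X.toRows₁ C proto)
    -- knockoff of the whole second half of the design, and the statistic
    (Xk₂ : Matrix (Fin n₂) (Fin p) ℝ) (hXk₂ : Protolasso.IsKnockoff X.toRows₂ Xk₂)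
    (W : Matrix (Fin n₂) (Fin K) ℝ → Matrix (Fin n₂) (Fin K) ℝ → (Fin n₂ → ℝ) → Fin K → ℝ)
    (hW : Protolasso.IsKnockoffStatistic W)
    (q : ℝ) (hq : q ∈ Set.Icc (0 : ℝ) 1) :
    Integrable (fun ω => Protolasso.fdp β (proto (y ω ∘ Sum.inl))
        (Protolasso.selected q (Protolasso.procedureStat X.toRows₂ Xk₂ proto W (y ω)))) μ ∧
      ∫ ω, Protolasso.fdp β (proto (y ω ∘ Sum.inl))
        (Protolasso.selected q (Protolasso.procedureStat X.toRows₂ Xk₂ proto W (y ω))) ∂μ ≤ q := by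
  set F : (Fin n₁ ⊕ Fin n₂ → ℝ) → ℝ := fun y => Protolasso.fdp β (proto (y ∘ Sum.inl))
    (Protolasso.selected q (Protolasso.procedureStat X.toRows₂ Xk₂ proto W y)) with hF
  set G : (Fin n₁ ⊕ Fin n₂ → ℝ) → ℝ := fun e => F (X.mulVec β + e) with hG
  have hFm : Measurable F :=
    Protolasso.measurable_fdp_procedureStat X.toRows₂ Xk₂ hproto.measurable hW β q
  have hGm : Measurable G := hFm.comp (measurable_const_add _)
  have hGb : ∀ e, ‖G e‖ ≤ 1 := fun e => by
    have := Protolasso.fdp_mem_Icc β (proto ((X.mulVec β + e) ∘ Sum.inl))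
      (Protolasso.selected q (Protolasso.procedureStat X.toRows₂ Xk₂ proto W (X.mulVec β + e)))
    rw [hG, hF, Real.norm_of_nonneg this.1]
    exact this.2
  have hεm : AEMeasurable ε μ := aemeasurable_pi_lambda _ fun i => (hε_law i).aemeasurable
  have hyG : (fun ω => F (y ω)) = fun ω => G (ε ω) := by
    funext ω
    rw [hG, hy]
  change Integrable (fun ω => F (y ω)) μ ∧ ∫ ω, F (y ω) ∂μ ≤ q
  rw [hyG]
  refine ⟨Integrable.of_bound (hGm.comp_aemeasurable hεm).aestronglyMeasurable 1
    (.of_forall fun ω => hGb _), ?_⟩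
  have hlaw : μ.map ε = Measure.pi fun _ => gaussianReal 0 (σ ^ 2) := by
    have h := (iIndepFun_iff_map_fun_eq_pi_map fun i => (hε_law i).aemeasurable).1 hε_indep
    simp only [(hε_law _).map_eq] at h
    exact h
  set γ₁ : Measure (Fin n₁ → ℝ) := Measure.pi fun _ => gaussianReal 0 (σ ^ 2)
  set γ₂ : Measure (Fin n₂ → ℝ) := Measure.pi fun _ => gaussianReal 0 (σ ^ 2) with hγ₂
  have hmp := measurePreserving_sumPiEquivProdPi_symm (X := fun _ : Fin n₁ ⊕ Fin n₂ => ℝ)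
    fun _ => gaussianReal 0 (σ ^ 2)
  have hprod : ∫ ω, G (ε ω) ∂μ = ∫ x, G (Sum.elim x.1 x.2) ∂(γ₁.prod γ₂) := by
    rw [← integral_map hεm hGm.aestronglyMeasurable, hlaw, ← hmp.map_eq,
      integral_map hmp.measurable.aemeasurable hGm.aestronglyMeasurable]
    refine integral_congr_ae (.of_forall fun x => ?_)
    congr 1
  have helim : Measurable fun x : (Fin n₁ → ℝ) × (Fin n₂ → ℝ) =>
      (Sum.elim x.1 x.2 : Fin n₁ ⊕ Fin n₂ → ℝ) := by
    refine measurable_pi_lambda _ ?_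
    rintro (i | i)
    · exact (measurable_pi_apply i).comp measurable_fst
    · exact (measurable_pi_apply i).comp measurable_snd
  have hint : Integrable (fun x : (Fin n₁ → ℝ) × (Fin n₂ → ℝ) => G (Sum.elim x.1 x.2))
      (γ₁.prod γ₂) :=
    Integrable.of_bound (hGm.comp helim).aestronglyMeasurable 1 (.of_forall fun x => hGb _)
  -- With the first-half noise frozen, the prototypes and hence the null set `N` are deterministic,
  -- and the noise `e₂` still has law `γ₂` by independence.
  have hcond : ∀ e₁, ∫ e₂, G (Sum.elim e₁ e₂) ∂γ₂ ≤ q := by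
    intro e₁
    set P := proto (X.toRows₁.mulVec β + e₁) with hP
    set N := Finset.univ.filter fun k => β (P k) = 0 with hN
    set w : (Fin n₂ → ℝ) → Fin K → ℝ := fun e => W (Protolasso.reduceCols X.toRows₂ P)
      (Protolasso.reduceCols Xk₂ P) (X.toRows₂.mulVec β + e) with hw
    have hwm : Measurable w := (hW.measurable _ _).comp (measurable_const_add _)
    have : IsProbabilityMeasure (γ₂.map w) := Measure.isProbabilityMeasure_map hwm.aemeasurable
    have hle := Protolasso.integral_card_filter_selected_div_le hq.1 N (γ₂.map w) fun j hj =>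
      Protolasso.measurePreserving_flipAt_statistic hXk₂ (hproto.injective hC _) hW (σ ^ 2)
        (Finset.mem_filter.1 hj).2
    rw [integral_map hwm.aemeasurable
      (Protolasso.measurable_card_filter_selected_div q N).aestronglyMeasurable] at hle
    refine le_of_eq_of_le (integral_congr_ae (.of_forall fun e₂ => ?_)) hle
    exact Protolasso.fdp_eq β P (Protolasso.selected q (w e₂))
  rw [hprod, integral_prod _ hint]
  calc ∫ e₁, ∫ e₂, G (Sum.elim e₁ e₂) ∂γ₂ ∂γ₁ ≤ ∫ _e₁, q ∂γ₁ :=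
        integral_mono hint.integral_prod_left (integrable_const _) hcond
    _ = q := by simp
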